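/- Let $K$ be a field, let $A$ be a finite dimensional (associative, unital) $K$-algebra, and let all modules be left $A$-modules. A finite dimensional $A$-module $T$ is called a tilting module if $\operatorname{pdim} T\le 1$, $\operatorname{Ext}^1_A(T,T)=0$, and the number of isomorphism classes of indecomposable direct summands of $T$ equals the number of isomorphism classes of simple $A$-modules. For a module $M$, let $\operatorname{add} M$ be the class of all modules isomorphic to finite direct sums of direct summands of $M$. Let $n$ be a natural number and let $X=X_1\oplus\dots\oplus X_n$ and $Y=Y_1\oplus\dots\oplus Y_n$ be finite dimensional multiplicity free tilting $A$-modules with all $X_i$ and $Y_i$ indecomposable (multiplicity free: $X_i\not\simeq X_j$ and $Y_i\not\simeq Y_j$ for $i\ne j$). Then there is a permutation $s$ of $\{1,\dots,n\}$ such that the following hold for every $i\in\{1,\dots,n\}$: (i) If $X_i$ is projective, then either $X_i\in\operatorname{add} Y$ or there is a non-split exact sequence $0\to X_i\to M\to Y_{s(i)}\to 0$ for some $A$-module $M$. (ii) If $X_i$ is injective, then either $X_i\in\operatorname{add} Y$ or there is a non-split exact sequence $0\to Y_{s(i)}\to M\to X_i\to 0$ for some $A$-module $M$. (iii) If $X_i$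 is projective and injective, then $X_i\in\operatorname{add} Y$ and $X_i\simeq Y_{s(i)}$. -/

import Mathlib

open scoped DirectSum

universe u w

namespace Tilting

/-- A module is indecomposable if it is nonzero and is not the internal direct sum of two
nonzero submodules. -/
def IsIndecomposable (A : Type u) [Ring A] (M : Type u) [AddCommGroup M] [Module A M] : Prop :=
  Nontrivial M ∧ ∀ N N' : Submodule A M, IsCompl N N' → N = ⊥ ∨ N' = ⊥

/-- `N` belongs to `add M`: it is isomorphic to a finite direct sum of direct summands of `M`. -/
def MemAdd (A : Type u) [Ring A] (N M : Type u) [AddCommGroup N] [Module A N]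
    [AddCommGroup M] [Module A M] : Prop :=
  ∃ (k : ℕ) (D : Fin k → Submodule A M),
    (∀ j, IsComplemented (D j)) ∧ Nonempty (N ≃ₗ[A] ⨁ j, D j)

/-- The isomorphism relation on the indecomposable direct summands of `T`. -/
def indecSummandSetoid (A : Type u) [Ring A] (T : Type u) [AddCommGroup T] [Module A T] :
    Setoid {N : Submodule A T // IsComplemented N ∧ IsIndecomposable A N} where
  r N N' := Nonempty (N.1 ≃ₗ[A] N'.1)
  iseqv :=
    { refl := fun N => ⟨LinearEquiv.refl A N.1⟩
      symm := fun ⟨e⟩ => ⟨e.symm⟩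
      trans := fun ⟨e⟩ ⟨e'⟩ => ⟨e.trans e'⟩ }

/-- The isomorphism relation on the simple `A`-modules. -/
def simpleSetoid (A : Type u) [Ring A] :
    Setoid {S : ModuleCat.{u} A // IsSimpleModule A S} where
  r S S' := Nonempty (S.1 ≃ₗ[A] S'.1)
  iseqv :=
    { refl := fun S => ⟨LinearEquiv.refl A S.1⟩
      symm := fun ⟨e⟩ => ⟨e.symm⟩
      trans := fun ⟨e⟩ ⟨e'⟩ => ⟨e.trans e'⟩ }

/-- The defining conditions of a (classical) tilting module, for a finite dimensional module `T`
over a finite dimensional algebra `A`. In that situation both quotients in `card_eq` are finite,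
so that a bijection between them says that they have the same number of elements. -/
structure IsTilting (A : Type u) [Ring A] (T : Type u) [AddCommGroup T] [Module A T] : Prop where
  /-- The projective dimension of `T` is at most one. -/
  pdim_le_one : CategoryTheory.HasProjectiveDimensionLE (ModuleCat.of A T) 1
  /-- `Ext¹(T, T) = 0`. -/
  ext_self : Subsingleton
    (CategoryTheory.Abelian.Ext.{u} (ModuleCat.of A T) (ModuleCat.of A T) 1)
  /-- The number of isomorphism classes of indecomposable direct summands of `T` is the number of
  isomorphism classes of simple `A`-modules. -/
  card_eq : Nonempty (Quotient (indecSummandSetoid A T) ≃ Quotient (simpleSetoid A))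

/-- There is a non-split exact sequence `0 → U → M → W → 0` for some `A`-module `M`. -/
def ExistsNonsplit (A : Type u) [Ring A] (U W : Type u) [AddCommGroup U] [Module A U]
    [AddCommGroup W] [Module A W] : Prop :=
  ∃ (M : ModuleCat.{u} A) (f : U →ₗ[A] M) (g : M →ₗ[A] W),
    Function.Injective f ∧ Function.Exact f g ∧ Function.Surjective g ∧
      ¬ ∃ h : W →ₗ[A] M, g ∘ₗ h = LinearMap.id

end Tilting

/-!
The permutation comes from Hall's marriage theorem. Relate `i` to `j` if `X i ≃ Y j`, or if there
is a non-split extension of `Y j` by `X i` or of `X i` by `Y j`; indices `i` for which `X i` is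
neither projective nor injective are related to every `j`. A permutation `s` whose graph lies in
this relation is as required, since a projective module is never the right end, and an injective
module never the left end, of a non-split extension. If `X i` is both, only `X i ≃ Y (s i)` is left.

To verify Hall's condition, let `I` be a set of indices `i` with `X i` projective or injective, and
let `J` be the set of indices related to a member of `I`. By the definition of `J` and the rigidity
of the two tilting modules, the modules `X i` with `i ∈ I` and `Y j` with `j ∉ J` are pairwise
non-isomorphic and have no extensions among each other. A family of indecomposable modules of
projective dimension at most one with this property has at most as many members as there are simple
modules (`card_le_of_partial_tilting`), and that number is at most `n`
(`IsTilting.card_simple_le`, from the Krull–Schmidt theorem). Hence `|I| + (n - |J|) ≤ n`.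

The bound on such a rigid family `Z` (`card_le_of_extVanishes`) is obtained as follows. The Euler
form `dim Hom(Z i, M) - dim Ext¹(Z i, M)` is additive in `M`, so it is determined by its values at
the simple modules. If there are more members than simple modules, then the Euler forms satisfy an
integral relation `∑ a i * χ(Z i, M) = 0`, which for modules `M` without extensions by the `Z i`
is a relation between dimensions of Hom spaces. These `M` form a class that is closed under
quotients and finite sums. In particular it contains the trace in `Z q` of the modules with
positive coefficients; comparing the relation for this trace with the one for `Z q` shows that the
two coincide when `a q < 0` (`trace_eq_top_of_relation`). So the members with positive and those
with negative coefficients generate each other, which forces a common member up to isomorphism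
(`exists_equiv_of_generate`), against the assumption.
-/

namespace Tilting

/-! ### Dimensions of Hom spaces and the Euler form -/

section HomDimension

variable (K : Type w) [Field K] {A : Type u} [Ring A] [Algebra K A]

/-- Composition with an `A`-linear map `g`, as a `K`-linear map `Hom(P, M) → Hom(P, N)`. -/
def postcomp (P : Type*) {M N : Type*} [AddCommGroup P] [Module A P]
    [AddCommGroup M] [Module A M] [Module K M] [IsScalarTower K A M]
    [AddCommGroup N] [Module A N] [Module K N] [IsScalarTower K A N] (g : M →ₗ[A] N) :
    (P →ₗ[A] M) →ₗ[K] (P →ₗ[A] N) where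
  toFun f := g ∘ₗ f
  map_add' f f' := LinearMap.comp_add f f' g
  map_smul' c f := LinearMap.ext fun x => g.map_smul_of_tower c (f x)

/-- Composition with an `A`-linear map `h`, as a `K`-linear map `Hom(Q, M) → Hom(P, M)`. -/
def precomp {P Q : Type*} (M : Type*) [AddCommGroup P] [Module A P] [AddCommGroup Q] [Module A Q]
    [AddCommGroup M] [Module A M] [Module K M] [IsScalarTower K A M] (h : P →ₗ[A] Q) :
    (Q →ₗ[A] M) →ₗ[K] (P →ₗ[A] M) where
  toFun f := f ∘ₗ h
  map_add' f f' := LinearMap.add_comp h f' f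
  map_smul' _ _ := rfl

variable {P Z M N : Type*} [AddCommGroup P] [Module A P] [AddCommGroup Z] [Module A Z]
  [AddCommGroup M] [Module A M] [Module K M] [IsScalarTower K A M]
  [AddCommGroup N] [Module A N] [Module K N] [IsScalarTower K A N]

theorem finiteDimensional_hom (P M : Type*) [AddCommGroup P] [Module A P]
    [AddCommGroup M] [Module A M] [Module K M] [IsScalarTower K A M]
    [Module.Finite A P] [FiniteDimensional K M] :
    FiniteDimensional K (P →ₗ[A] M) := by
  obtain ⟨r, s, hs⟩ := Module.Finite.exists_fin (R := A) (M := P)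
  let ev : (P →ₗ[A] M) →ₗ[K] (Fin r → M) :=
    { toFun := fun f i => f (s i)
      map_add' := fun _ _ => rfl
      map_smul' := fun _ _ => rfl }
  refine Module.Finite.of_injective ev fun f g h => ?_
  refine LinearMap.ext_on_range hs fun i => congrFun h i

/-- `Hom(P, -)` is exact for a projective module `P`. -/
theorem finrank_hom_eq_add [Module.Finite A P] [Module.Projective A P] [FiniteDimensional K M]
    (L : Submodule A M) :
    Module.finrank K (P →ₗ[A] M) =
      Module.finrank K (P →ₗ[A] L) + Module.finrank K (P →ₗ[A] M ⧸ L) := by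
  have := finiteDimensional_hom (A := A) K P M
  have h := LinearMap.finrank_range_add_finrank_ker (postcomp K P L.mkQ)
  have h1 : LinearMap.range (postcomp K P L.mkQ) = ⊤ := by
    refine LinearMap.range_eq_top.2 fun f => ?_
    exact Module.projective_lifting_property L.mkQ f L.mkQ_surjective
  have h2 : LinearMap.ker (postcomp K P L.mkQ) = LinearMap.range (postcomp K P L.subtype) := by
    ext f
    constructor
    · intro hf
      have hf' : ∀ x, f x ∈ L := fun x => by
        have := LinearMap.congr_fun (LinearMap.mem_ker.1 hf) x
        exact (Submodule.Quotient.mk_eq_zero L).1 this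
      exact ⟨f.codRestrict L hf', LinearMap.ext fun _ => rfl⟩
    · rintro ⟨g, rfl⟩
      exact LinearMap.mem_ker.2 (LinearMap.ext fun x =>
        (Submodule.Quotient.mk_eq_zero L).2 (g x).2)
  have h3 : Function.Injective (postcomp K P L.subtype) := fun f g hfg =>
    LinearMap.ext fun x => Subtype.ext (LinearMap.congr_fun hfg x)
  rw [h1, finrank_top, h2, LinearMap.finrank_range_of_inj h3] at h
  omega

theorem finrank_hom_congr (P : Type*) [AddCommGroup P] [Module A P] (e : M ≃ₗ[A] N) :
    Module.finrank K (P →ₗ[A] M) = Module.finrank K (P →ₗ[A] N) :=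
  LinearEquiv.finrank_eq
    { postcomp K P e.toLinearMap with
      invFun := postcomp K P e.symm.toLinearMap
      left_inv := fun f => LinearMap.ext fun x => e.symm_apply_apply (f x)
      right_inv := fun f => LinearMap.ext fun x => e.apply_symm_apply (f x) }

/-- The Euler form `dim Hom(P, M) - dim Hom(ker π, M)` of a module `Z` presented by a surjection
`π : P → Z`, with values in a module `M`. For projective `P` and `ker π`, this is
`dim Hom(Z, M) - dim Ext¹(Z, M)`. -/
noncomputable def eulerForm (π : P →ₗ[A] Z) (M : Type*) [AddCommGroup M] [Module A M] [Module K M]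
    [IsScalarTower K A M] : ℤ :=
  Module.finrank K (P →ₗ[A] M) - Module.finrank K (LinearMap.ker π →ₗ[A] M)

theorem eulerForm_congr (π : P →ₗ[A] Z) (e : M ≃ₗ[A] N) :
    eulerForm K π M = eulerForm K π N := by
  rw [eulerForm, eulerForm, finrank_hom_congr K P e, finrank_hom_congr K (LinearMap.ker π) e]

theorem eulerForm_eq_add [IsNoetherianRing A] [Module.Finite A P] [Module.Projective A P]
    [FiniteDimensional K M] (π : P →ₗ[A] Z) [Module.Projective A (LinearMap.ker π)]
    (L : Submodule A M) :
    eulerForm K π M = eulerForm K π L + eulerForm K π (M ⧸ L) := by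
  rw [eulerForm, eulerForm, eulerForm, finrank_hom_eq_add K L,
    finrank_hom_eq_add (P := LinearMap.ker π) K L]
  push_cast
  ring

theorem eulerForm_of_subsingleton [Subsingleton M] (π : P →ₗ[A] Z) : eulerForm K π M = 0 := by
  have : Subsingleton (P →ₗ[A] M) := ⟨fun f g => LinearMap.ext fun x => Subsingleton.elim _ _⟩
  have : Subsingleton (LinearMap.ker π →ₗ[A] M) :=
    ⟨fun f g => LinearMap.ext fun x => Subsingleton.elim _ _⟩
  simp [eulerForm, Module.finrank_zero_of_subsingleton]

/-- Every map `ker π → M` extends along `ker π → P`. For a surjection `π : P → Z` with `P`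
projective this says that `Ext¹(Z, M) = 0`. -/
def ExtVanishes (π : P →ₗ[A] Z) (M : Type*) [AddCommGroup M] [Module A M] : Prop :=
  ∀ f : LinearMap.ker π →ₗ[A] M, ∃ g : P →ₗ[A] M, g ∘ₗ (LinearMap.ker π).subtype = f

theorem ExtVanishes.finrank_hom [IsNoetherianRing A] [Module.Finite A P] [FiniteDimensional K M]
    {π : P →ₗ[A] Z} (hπ : Function.Surjective π) (h : ExtVanishes π M) :
    (Module.finrank K (Z →ₗ[A] M) : ℤ) = eulerForm K π M := by
  have := finiteDimensional_hom (A := A) K P M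
  have h0 := LinearMap.finrank_range_add_finrank_ker (precomp K M (LinearMap.ker π).subtype)
  have h1 : LinearMap.range (precomp K M (LinearMap.ker π).subtype) = ⊤ :=
    LinearMap.range_eq_top.2 h
  have h2 : LinearMap.ker (precomp K M (LinearMap.ker π).subtype) =
      LinearMap.range (precomp K M π) := by
    ext f
    constructor
    · intro hf
      have hf' : LinearMap.ker π ≤ LinearMap.ker f := fun x hx =>
        LinearMap.congr_fun (LinearMap.mem_ker.1 hf) ⟨x, hx⟩
      let e := π.quotKerEquivOfSurjective hπ
      refine ⟨(LinearMap.ker π).liftQ f hf' ∘ₗ e.symm.toLinearMap, LinearMap.ext fun x => ?_⟩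
      have : e.symm (π x) = Submodule.Quotient.mk x := by
        rw [LinearEquiv.symm_apply_eq]; rfl
      change (LinearMap.ker π).liftQ f hf' (e.symm (π x)) = f x
      rw [this]; rfl
    · rintro ⟨g, rfl⟩
      refine LinearMap.mem_ker.2 (LinearMap.ext fun x => ?_)
      change g (π x) = 0
      rw [LinearMap.mem_ker.1 x.2, map_zero]
  have h3 : Function.Injective (precomp K M π) := fun f g hfg => LinearMap.ext fun z => by
    obtain ⟨x, rfl⟩ := hπ z
    exact LinearMap.congr_fun hfg x
  rw [h1, finrank_top, h2, LinearMap.finrank_range_of_inj h3] at h0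
  rw [eulerForm, ← h0]
  push_cast
  ring

/-- An integral relation between Euler forms that holds at all simple modules holds at all
finite dimensional modules. -/
theorem sum_eulerForm_eq_zero [IsNoetherianRing A] {ι : Type*} [Fintype ι]
    {P Z : ι → Type u} [∀ i, AddCommGroup (P i)] [∀ i, Module A (P i)]
    [∀ i, AddCommGroup (Z i)] [∀ i, Module A (Z i)]
    [∀ i, Module.Finite A (P i)] [∀ i, Module.Projective A (P i)]
    (π : ∀ i, P i →ₗ[A] Z i) [∀ i, Module.Projective A (LinearMap.ker (π i))] (a : ι → ℤ)
    (hsimple : ∀ (S : Type u) [AddCommGroup S] [Module A S] [Module K S] [IsScalarTower K A S],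
      IsSimpleModule A S → ∑ i, a i * eulerForm K (π i) S = 0)
    (M : Type u) [AddCommGroup M] [Module A M] [Module K M] [IsScalarTower K A M]
    [FiniteDimensional K M] :
    ∑ i, a i * eulerForm K (π i) M = 0 := by
  induction hd : Module.finrank K M using Nat.strong_induction_on generalizing M with
  | _ d ih =>
    rcases subsingleton_or_nontrivial M with hM | hM
    · simp [eulerForm_of_subsingleton]
    · have : IsArtinian A M := isArtinian_of_tower K inferInstance
      obtain ⟨L, hL, -⟩ := (eq_bot_or_exists_atom_le (⊤ : Submodule A M)).resolve_left top_ne_bot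
      have hLs : IsSimpleModule A L := (isSimpleModule_iff_isAtom).2 hL
      have hlt : Module.finrank K (M ⧸ L) < d := by
        have : Nontrivial L := IsSimpleModule.nontrivial A L
        have h1 := Submodule.finrank_quotient_add_finrank (L.restrictScalars K)
        have h2 : 0 < Module.finrank K (L.restrictScalars K) :=
          Module.finrank_pos_iff.2 (inferInstanceAs (Nontrivial L))
        have h3 : Module.finrank K (M ⧸ L) = Module.finrank K (M ⧸ L.restrictScalars K) :=
          LinearEquiv.finrank_eq (Submodule.Quotient.restrictScalarsEquiv K L).symm
        omega
      have hq := ih _ hlt (M ⧸ L) rfl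
      have hl := hsimple L hLs
      simp only [eulerForm_eq_add K (π _) L, mul_add, Finset.sum_add_distrib, hq, hl, add_zero]

end HomDimension

/-! ### Modules without extensions, and traces -/

section Trace

variable {A : Type u} [Ring A] {P W M N : Type*} [AddCommGroup P] [Module A P]
  [AddCommGroup W] [Module A W] [AddCommGroup M] [Module A M] [AddCommGroup N] [Module A N]

/-- If `W` has projective dimension at most one, the class of modules `M` with `Ext¹(W, M) = 0` is
closed under quotients. -/
theorem ExtVanishes.of_surjective {π : P →ₗ[A] W} [Module.Projective A (LinearMap.ker π)]
    (h : ExtVanishes π M) (p : M →ₗ[A] N) (hp : Function.Surjective p) : ExtVanishes π N := by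
  intro f
  obtain ⟨f', rfl⟩ := Module.projective_lifting_property p f hp
  obtain ⟨g, rfl⟩ := h f'
  exact ⟨p ∘ₗ g, rfl⟩

theorem ExtVanishes.prod {π : P →ₗ[A] W} (hM : ExtVanishes π M) (hN : ExtVanishes π N) :
    ExtVanishes π (M × N) := by
  intro f
  obtain ⟨g, hg⟩ := hM (LinearMap.fst A M N ∘ₗ f)
  obtain ⟨h, hh⟩ := hN (LinearMap.snd A M N ∘ₗ f)
  exact ⟨g.prod h, LinearMap.ext fun x =>
    Prod.ext (LinearMap.congr_fun hg x) (LinearMap.congr_fun hh x)⟩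

theorem ExtVanishes.sup {π : P →ₗ[A] W} [Module.Projective A (LinearMap.ker π)]
    {L L' : Submodule A M} (hL : ExtVanishes π L) (hL' : ExtVanishes π L') :
    ExtVanishes π ↥(L ⊔ L') := by
  refine (hL.prod hL').of_surjective
    ((Submodule.inclusion le_sup_left).coprod (Submodule.inclusion le_sup_right)) ?_
  rintro ⟨x, hx⟩
  obtain ⟨y, hy, z, hz, rfl⟩ := Submodule.mem_sup.1 hx
  exact ⟨(⟨y, hy⟩, ⟨z, hz⟩), rfl⟩

variable {ι : Type*} (Z : ι → Type u) [∀ i, AddCommGroup (Z i)] [∀ i, Module A (Z i)]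

variable (A) in
/-- The trace of the modules `Z i`, `i ∈ s`, in `M`: the sum of the images of all maps
`Z i → M` with `i ∈ s`. -/
def trace (s : Set ι) (M : Type*) [AddCommGroup M] [Module A M] : Submodule A M :=
  ⨆ x : (Σ i : s, Z i →ₗ[A] M), LinearMap.range x.2

variable {Z}

theorem range_le_trace {s : Set ι} {i : ι} (hi : i ∈ s) (f : Z i →ₗ[A] M) :
    LinearMap.range f ≤ trace A Z s M :=
  le_iSup (fun x : (Σ i : s, Z i →ₗ[A] M) => LinearMap.range x.2) ⟨⟨i, hi⟩, f⟩

theorem trace_le {s : Set ι} {L : Submodule A M}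
    (h : ∀ i ∈ s, ∀ f : Z i →ₗ[A] M, LinearMap.range f ≤ L) : trace A Z s M ≤ L :=
  iSup_le fun x => h x.1 x.1.2 x.2

theorem map_trace_le (s : Set ι) (g : M →ₗ[A] N) :
    (trace A Z s M).map g ≤ trace A Z s N := by
  refine Submodule.map_le_iff_le_comap.2 (trace_le fun i hi f => ?_)
  rw [← Submodule.map_le_iff_le_comap, ← LinearMap.range_comp]
  exact range_le_trace hi (g ∘ₗ f)

theorem trace_le_trace {s t : Set ι} (h : ∀ i ∈ s, trace A Z t (Z i) = ⊤) :
    trace A Z s M ≤ trace A Z t M := by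
  refine trace_le fun i hi f => ?_
  rw [LinearMap.range_eq_map, ← h i hi]
  exact map_trace_le t f

theorem ExtVanishes.trace {π : P →ₗ[A] N} [Module.Projective A (LinearMap.ker π)]
    [IsNoetherian A M] {s : Set ι} (h : ∀ i ∈ s, ExtVanishes π (Z i)) :
    ExtVanishes π (Tilting.trace A Z s M) := by
  -- Since `M` is noetherian, the trace lies in every set of submodules that is closed under
  -- finite suprema and contains the images.
  obtain ⟨t, ht, htr⟩ := CompleteLattice.WellFoundedGT.isSupFiniteCompact (Submodule A M)
    (Set.range fun x : (Σ i : s, Z i →ₗ[A] M) => LinearMap.range x.2)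
  have key : ∀ t : Finset (Submodule A M), (∀ L ∈ t, ExtVanishes π L) →
      ExtVanishes π ↥(t.sup id) := by
    classical
    intro t
    induction t using Finset.induction_on with
    | empty =>
      intro _ f
      exact ⟨0, LinearMap.ext fun x => Subsingleton.elim (α := (⊥ : Submodule A M)) _ _⟩
    | insert L t _ ih =>
      intro hL
      rw [Finset.sup_insert]
      exact (hL L (Finset.mem_insert_self L t)).sup
        (ih fun L' hL' => hL L' (Finset.mem_insert_of_mem hL'))
  have hT : Tilting.trace A Z s M = t.sup id := htr
  rw [hT]
  refine key t fun L hL => ?_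
  obtain ⟨x, rfl⟩ := ht hL
  exact (h x.1 x.1.2).of_surjective x.2.rangeRestrict x.2.surjective_rangeRestrict

end Trace

/-! ### Indecomposable modules of finite length -/

section LocalEndomorphismRing

variable {A : Type u} [Ring A]

/-- Fitting's lemma. -/
theorem IsIndecomposable.isUnit_or_isNilpotent {M : Type u} [AddCommGroup M] [Module A M]
    [IsNoetherian A M] [IsArtinian A M] (hM : IsIndecomposable A M) (f : Module.End A M) :
    IsUnit f ∨ IsNilpotent f := by
  obtain ⟨n, hn, hn0⟩ := (f.eventually_isCompl_ker_pow_range_pow.and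
    (Filter.eventually_ge_atTop 1)).exists
  have hne : n ≠ 0 := by omega
  rcases hM.2 _ _ hn with h | h
  · left
    rw [h] at hn
    have hb : Function.Bijective (f ^ n) :=
      ⟨LinearMap.ker_eq_bot.1 h, LinearMap.range_eq_top.1 (by simpa using hn.sup_eq_top)⟩
    exact (isUnit_pow_iff hne).1 ((Module.End.isUnit_iff _).2 hb)
  · right
    exact ⟨n, LinearMap.range_eq_bot.1 h⟩

theorem IsIndecomposable.isLocalRing_end {M : Type u} [AddCommGroup M] [Module A M]
    [IsNoetherian A M] [IsArtinian A M] (hM : IsIndecomposable A M) :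
    IsLocalRing (Module.End A M) := by
  have := hM.1
  refine IsLocalRing.of_isUnit_or_isUnit_one_sub_self fun f => ?_
  rcases hM.isUnit_or_isNilpotent f with h | h
  · exact Or.inl h
  · exact Or.inr h.isUnit_one_sub

theorem exists_isUnit_of_isUnit_sum {R : Type*} [Ring R] [IsLocalRing R] {ι : Type*}
    (s : Finset ι) (f : ι → R) (h : IsUnit (∑ i ∈ s, f i)) : ∃ i ∈ s, IsUnit (f i) := by
  classical
  induction s using Finset.induction_on with
  | empty => simp at h
  | insert i s hi ih =>
    rw [Finset.sum_insert hi] at h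
    obtain ⟨v, hv⟩ := h
    have h1 : ↑v⁻¹ * f i + ↑v⁻¹ * ∑ j ∈ s, f j = 1 := by
      rw [← mul_add, ← hv, Units.inv_mul]
    rcases IsLocalRing.isUnit_or_isUnit_of_add_one h1 with h | h
    · exact ⟨i, Finset.mem_insert_self _ _, (Units.isUnit_units_mul _ _).1 h⟩
    · obtain ⟨j, hj, hu⟩ := ih ((Units.isUnit_units_mul _ _).1 h)
      exact ⟨j, Finset.mem_insert_of_mem hj, hu⟩

theorem nonempty_equiv_of_isUnit_comp {M N : Type u} [AddCommGroup M] [Module A M]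
    [AddCommGroup N] [Module A N] [Nontrivial M] (hN : IsIndecomposable A N)
    (f : M →ₗ[A] N) (g : N →ₗ[A] M) (h : IsUnit (g ∘ₗ f : Module.End A M)) :
    Nonempty (M ≃ₗ[A] N) := by
  have hb : Function.Bijective (g ∘ₗ f) := (Module.End.isUnit_iff _).1 h
  have hc : IsCompl (LinearMap.range f) (LinearMap.ker g) := by
    refine ⟨Submodule.disjoint_def.2 ?_, codisjoint_iff.2 (eq_top_iff.2 fun y _ => ?_)⟩
    · rintro _ ⟨x, rfl⟩ hx
      have : x = 0 := hb.1 (by rw [map_zero]; exact hx)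
      rw [this, map_zero]
    · obtain ⟨x, hx⟩ := hb.2 (g y)
      refine Submodule.mem_sup.2 ⟨f x, ⟨x, rfl⟩, y - f x, ?_, by abel⟩
      rw [LinearMap.mem_ker, map_sub, sub_eq_zero]
      exact hx.symm
  have hinj : Function.Injective f := fun x y hxy => hb.1 (congrArg g hxy)
  rcases hN.2 _ _ hc with h0 | h0
  · obtain ⟨x, hx⟩ := exists_ne (0 : M)
    have : f x ∈ LinearMap.range f := ⟨x, rfl⟩
    rw [h0, Submodule.mem_bot] at this
    exact absurd (hinj (this.trans (map_zero f).symm)) hx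
  · rw [h0] at hc
    exact ⟨LinearEquiv.ofBijective f
      ⟨hinj, LinearMap.range_eq_top.1 (by simpa using hc.sup_eq_top)⟩⟩

/-- The uniqueness part of the Krull–Schmidt theorem: an indecomposable direct summand of a direct
sum of indecomposable modules is isomorphic to one of them. -/
theorem exists_equiv_of_isComplemented {n : ℕ} {X : Fin n → Type u} [∀ i, AddCommGroup (X i)]
    [∀ i, Module A (X i)] [∀ i, IsNoetherian A (X i)] [∀ i, IsArtinian A (X i)]
    (hX : ∀ i, IsIndecomposable A (X i)) (N : Submodule A (⨁ i, X i)) (hc : IsComplemented N)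
    (hN : IsIndecomposable A N) : ∃ i, Nonempty (N ≃ₗ[A] X i) := by
  let e : (⨁ i, X i) ≃ₗ[A] (∀ i, X i) := DirectSum.linearEquivFunOnFintype A (Fin n) X
  have : IsNoetherian A (⨁ i, X i) := isNoetherian_of_linearEquiv e.symm
  have : IsArtinian A (⨁ i, X i) := isArtinian_of_linearEquiv e.symm
  have := hN.isLocalRing_end
  have := hN.1
  obtain ⟨N', hc⟩ := hc
  let p := N.projectionOnto N' hc
  let φ : Fin n → Module.End A N := fun i =>
    (p ∘ₗ DirectSum.lof A (Fin n) X i) ∘ₗ (DirectSum.component A (Fin n) X i ∘ₗ N.subtype)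
  have hsum : ∑ i, φ i = 1 := by
    refine LinearMap.ext fun y => ?_
    rw [LinearMap.sum_apply]
    calc ∑ i, p (DirectSum.of X i (y.1 i)) = p (∑ i, DirectSum.of X i (y.1 i)) :=
          (map_sum p _ _).symm
      _ = p y.1 := by rw [DirectSum.sum_univ_of]
      _ = y := Submodule.projectionOnto_apply_left hc y
  obtain ⟨i, -, hi⟩ := exists_isUnit_of_isUnit_sum Finset.univ φ (hsum.symm ▸ isUnit_one)
  exact ⟨i, nonempty_equiv_of_isUnit_comp (hX i) _ _ hi⟩

end LocalEndomorphismRing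

/-! ### Families of modules that generate each other -/

section MutualGeneration

variable (K : Type w) [Field K] {A : Type u} [Ring A] [Algebra K A]

variable {ι : Type*} {Z : ι → Type u} [∀ i, AddCommGroup (Z i)] [∀ i, Module A (Z i)]

/-- If the trace of a family `Z j`, `j ∈ s`, of modules in an indecomposable module
`Z p` is proper, then any family that generates `Z p` and is generated by `Z p` and the `Z j`,
`j ∈ s`, has a member isomorphic to `Z p`. -/
theorem exists_equiv_of_trace_ne_top
    [∀ i, Module K (Z i)] [∀ i, IsScalarTower K A (Z i)] [∀ i, FiniteDimensional K (Z i)]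
    (hZ : ∀ i, IsIndecomposable A (Z i)) {p : ι} {s t : Set ι}
    (hs : trace A Z s (Z p) ≠ ⊤) (hpt : trace A Z t (Z p) = ⊤)
    (ht : ∀ j ∈ t, trace A Z (insert p s) (Z j) = ⊤) :
    ∃ j ∈ t, Nonempty (Z p ≃ₗ[A] Z j) := by
  have : IsNoetherian A (Z p) := isNoetherian_of_tower K inferInstance
  have : IsArtinian A (Z p) := isArtinian_of_tower K inferInstance
  have := (hZ p).isLocalRing_end
  have := (hZ p).1
  have hfin : Module.Finite (Module.End A (Z p)) (Z p) :=
    Module.Finite.of_restrictScalars_finite K _ _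
  by_contra! hno
  let W : Submodule (Module.End A (Z p)) (Z p) :=
    { trace A Z s (Z p) with
      smul_mem' := fun φ x hx => map_trace_le s φ ⟨x, hx, rfl⟩ }
  have hW : W ≠ ⊤ := fun h => hs (eq_top_iff.2 fun x _ => (h ▸ trivial : x ∈ W))
  obtain ⟨V, hV, hWV⟩ := (eq_top_or_exists_le_coatom W).resolve_left hW
  -- A non-invertible endomorphism maps `Z p` into every maximal `End (Z p)`-submodule.
  have hrad : ∀ φ : Module.End A (Z p), ¬ IsUnit φ → ∀ z, φ z ∈ V := by
    intro φ hφ z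
    by_contra hz
    have htop : V ⊔ Submodule.span (Module.End A (Z p)) {φ z} = ⊤ :=
      hV.2 _ (left_lt_sup.2 fun h => hz (h (Submodule.mem_span_singleton_self _)))
    obtain ⟨v, hv, y, hy, hvy⟩ := Submodule.mem_sup.1 (htop.ge (Submodule.mem_top (x := z)))
    obtain ⟨ψ, rfl⟩ := Submodule.mem_span_singleton.1 hy
    have hu : IsUnit (1 - ψ * φ) := by
      refine (IsLocalRing.isUnit_or_isUnit_of_add_one (add_sub_cancel (ψ * φ) 1)).resolve_left fun h => hφ ?_
      have hb := (Module.End.isUnit_iff _).1 h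
      exact (Module.End.isUnit_iff _).2
        (IsArtinian.bijective_of_injective_endomorphism φ fun x y hxy => hb.1 (congrArg ψ hxy))
    obtain ⟨χ, hχ⟩ := hu.exists_left_inv
    have hv' : (1 - ψ * φ) • z = v := by
      rw [sub_smul, one_smul, mul_smul]
      exact sub_eq_of_eq_add hvy.symm
    have hzV : z ∈ V := by
      rw [← one_smul (Module.End A (Z p)) z, ← hχ, mul_smul, hv']
      exact V.smul_mem χ hv
    exact hz (V.smul_mem φ hzV)
  refine hV.1 (eq_top_iff.2 fun x _ => ?_)
  have hx : x ∈ trace A Z t (Z p) := hpt ▸ trivial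
  refine Submodule.iSup_induction _ (motive := fun x => x ∈ V) hx ?_ V.zero_mem
    (fun _ _ => V.add_mem)
  rintro ⟨⟨j, hj⟩, g⟩ _ ⟨y, rfl⟩
  have hy : y ∈ trace A Z (insert p s) (Z j) := ht j hj ▸ trivial
  refine Submodule.iSup_induction _ (motive := fun y => g y ∈ V) hy ?_ ?_ ?_
  · rintro ⟨⟨i, hi⟩, f⟩ _ ⟨z, rfl⟩
    rcases hi with rfl | hi
    · -- Were `g ∘ f : Z i → Z j → Z i` invertible, `Z i` would split off from `Z j`.
      refine hrad (g ∘ₗ f) (fun hu => ?_) z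
      obtain ⟨e⟩ := nonempty_equiv_of_isUnit_comp (hZ j) f g hu
      exact (hno j hj).false e
    · exact hWV (range_le_trace hi (g ∘ₗ f) ⟨z, rfl⟩)
  · rw [map_zero]
    exact V.zero_mem
  · intro y y' hy hy'
    rw [map_add]
    exact V.add_mem hy hy'

/-- Two nonempty families of indecomposable modules that generate each other have a member in
common up to isomorphism: each member of a minimal generating subfamily of the first family is a
direct summand of any finite sum of generated modules that maps onto it. -/
theorem exists_equiv_of_generate [Finite ι]
    [∀ i, Module K (Z i)] [∀ i, IsScalarTower K A (Z i)] [∀ i, FiniteDimensional K (Z i)]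
    (hZ : ∀ i, IsIndecomposable A (Z i)) {s t : Set ι} (hs : s.Nonempty)
    (hst : ∀ j ∈ t, trace A Z s (Z j) = ⊤) (hts : ∀ i ∈ s, trace A Z t (Z i) = ⊤) :
    ∃ i ∈ s, ∃ j ∈ t, Nonempty (Z i ≃ₗ[A] Z j) := by
  -- The set `m` is a minimal subset of `s` that still generates all `Z i` with `i ∈ s`.
  obtain ⟨m, ⟨hms, hm⟩, hmin⟩ : ∃ m : Set ι, Minimal
      (fun m => m ⊆ s ∧ ∀ i ∈ s, trace A Z m (Z i) = ⊤) m := by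
    refine (Set.toFinite {m : Set ι | m ⊆ s ∧ ∀ i ∈ s, trace A Z m (Z i) = ⊤}).exists_minimal
      ⟨s, subset_rfl, fun i hi => ?_⟩
    rw [eq_top_iff]
    exact (LinearMap.range_id (R := A)).ge.trans (range_le_trace hi LinearMap.id)
  obtain ⟨i₀, hi₀⟩ := hs
  obtain ⟨p, hp⟩ : m.Nonempty := by
    rw [Set.nonempty_iff_ne_empty]
    rintro rfl
    have := (hZ i₀).1
    refine bot_ne_top (α := Submodule A (Z i₀)) (eq_top_iff.2 ?_)
    rw [← hm i₀ hi₀]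
    exact trace_le fun i hi => absurd hi (Set.notMem_empty i)
  have hins : insert p (m \ {p}) = m := by rw [Set.insert_sdiff_singleton, Set.insert_eq_of_mem hp]
  have hne : trace A Z (m \ {p}) (Z p) ≠ ⊤ := by
    intro h
    have hgen : ∀ i ∈ m, trace A Z (m \ {p}) (Z i) = ⊤ := by
      intro i hi
      by_cases hip : i = p
      · exact hip ▸ h
      · rw [eq_top_iff]
        exact (LinearMap.range_id (R := A)).ge.trans
          (range_le_trace (s := m \ {p}) ⟨hi, hip⟩ LinearMap.id)
    have hP : m \ {p} ⊆ s ∧ ∀ i ∈ s, trace A Z (m \ {p}) (Z i) = ⊤ :=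
      ⟨Set.sdiff_subset.trans hms, fun i hi =>
        eq_top_iff.2 ((hm i hi).ge.trans (trace_le_trace hgen))⟩
    have hle : m ⊆ m \ {p} := hmin hP Set.sdiff_subset
    exact (hle hp).2 rfl
  obtain ⟨j, hj, e⟩ := exists_equiv_of_trace_ne_top K hZ hne (hts p (hms hp)) (fun j hj => by
    rw [hins, eq_top_iff]
    exact (hst j hj).ge.trans (trace_le_trace hm))
  exact ⟨p, hms hp, j, hj, e⟩

end MutualGeneration

/-! ### The number of members of a rigid family -/

section RigidFamily

variable (K : Type w) [Field K] {A : Type u} [Ring A] [Algebra K A]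

theorem finiteDimensional_submodule {M : Type*} [AddCommGroup M] [Module A M] [Module K M]
    [IsScalarTower K A M] [FiniteDimensional K M] (L : Submodule A M) : FiniteDimensional K L :=
  inferInstanceAs (FiniteDimensional K (L.restrictScalars K))

/-- Suppose that the dimensions of the spaces `Hom(Z i, M)` satisfy the linear relation with
coefficients `a i`, both for `M = Z q` with `a q < 0` and for the trace `M` in `Z q` of the modules
with positive coefficients. Then the latter generate `Z q`: passing from `Z q` to the trace does
not change the terms with positive coefficients, and can only increase the others. -/
theorem trace_eq_top_of_relation {ι : Type*} [Fintype ι] {Z : ι → Type u}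
    [∀ i, AddCommGroup (Z i)] [∀ i, Module A (Z i)] [∀ i, Module K (Z i)]
    [∀ i, IsScalarTower K A (Z i)] [∀ i, FiniteDimensional K (Z i)] [∀ i, Module.Finite A (Z i)]
    (a : ι → ℤ) {q : ι} (hq : a q < 0)
    (h : ∑ i, a i * (Module.finrank K (Z i →ₗ[A] Z q) : ℤ) = 0)
    (htr : ∑ i, a i *
      (Module.finrank K (Z i →ₗ[A] trace A Z {i | 0 < a i} (Z q)) : ℤ) = 0) :
    trace A Z {i | 0 < a i} (Z q) = ⊤ := by
  set T := trace A Z {i | 0 < a i} (Z q) with hT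
  have := finiteDimensional_submodule K T
  have hinj : ∀ i, Function.Injective (postcomp K (Z i) T.subtype) := fun i f g hfg =>
    LinearMap.ext fun x => Subtype.ext (LinearMap.congr_fun hfg x)
  have hfd : ∀ i, FiniteDimensional K (Z i →ₗ[A] Z q) := fun i => finiteDimensional_hom K _ _
  have hle : ∀ i, Module.finrank K (Z i →ₗ[A] T) ≤ Module.finrank K (Z i →ₗ[A] Z q) := fun i =>
    LinearMap.finrank_le_finrank_of_injective (hinj i)
  have hterm : ∀ i ∈ Finset.univ, a i * (Module.finrank K (Z i →ₗ[A] Z q) : ℤ) -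
      a i * (Module.finrank K (Z i →ₗ[A] T) : ℤ) ≤ 0 := by
    intro i _
    rw [← mul_sub]
    rcases lt_or_ge 0 (a i) with hi | hi
    · have hsurj : Function.Surjective (postcomp K (Z i) T.subtype) := fun f =>
        ⟨f.codRestrict T fun x => range_le_trace (s := {i | 0 < a i}) hi f ⟨x, rfl⟩,
          LinearMap.ext fun _ => rfl⟩
      rw [LinearEquiv.finrank_eq (LinearEquiv.ofBijective _ ⟨hinj i, hsurj⟩), sub_self, mul_zero]
    · exact mul_nonpos_of_nonpos_of_nonneg hi (sub_nonneg.2 (by exact_mod_cast hle i))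
  have hz := (Finset.sum_eq_zero_iff_of_nonpos hterm).1
    (by rw [Finset.sum_sub_distrib, h, htr, sub_zero]) q (Finset.mem_univ q)
  rw [← mul_sub] at hz
  have heq := (mul_eq_zero.1 hz).resolve_left hq.ne
  have heq' : Module.finrank K (Z q →ₗ[A] T) = Module.finrank K (Z q →ₗ[A] Z q) := by omega
  have : FiniteDimensional K (Z q →ₗ[A] T) := finiteDimensional_hom K _ _
  obtain ⟨f, hf⟩ := (LinearMap.injective_iff_surjective_of_finrank_eq_finrank heq').1 (hinj q)
    LinearMap.id
  refine eq_top_iff.2 fun x _ => ?_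
  have hx : (f x : Z q) = x := LinearMap.congr_fun hf x
  exact hx ▸ (f x).2

/-- A family of pairwise non-isomorphic indecomposable modules of projective dimension at most one
without extensions between its members has at most as many members as there are simple modules.
Otherwise the Euler forms of the members would be linearly dependent, and the members with
positive and those with negative coefficients in a relation would generate each other. -/
theorem card_le_of_extVanishes [FiniteDimensional K A] [Finite (Quotient (simpleSetoid A))]
    {ι : Type*} [Fintype ι] {P Z : ι → Type u}
    [∀ i, AddCommGroup (P i)] [∀ i, Module A (P i)] [∀ i, Module.Finite A (P i)]
    [∀ i, Module.Projective A (P i)] [∀ i, AddCommGroup (Z i)] [∀ i, Module A (Z i)]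
    [∀ i, Module K (Z i)] [∀ i, IsScalarTower K A (Z i)] [∀ i, FiniteDimensional K (Z i)]
    (π : ∀ i, P i →ₗ[A] Z i) [∀ i, Module.Projective A (LinearMap.ker (π i))]
    (hπ : ∀ i, Function.Surjective (π i)) (hZ : ∀ i, IsIndecomposable A (Z i))
    (hne : ∀ i j, i ≠ j → IsEmpty (Z i ≃ₗ[A] Z j)) (hext : ∀ i j, ExtVanishes (π i) (Z j)) :
    Fintype.card ι ≤ Nat.card (Quotient (simpleSetoid A)) := by
  have : IsNoetherianRing A := isNoetherian_of_tower K inferInstance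
  have : ∀ i, Module.Finite A (Z i) := fun i => Module.Finite.of_restrictScalars_finite K _ _
  have : ∀ i, IsNoetherian A (Z i) := fun i => inferInstance
  have := Fintype.ofFinite (Quotient (simpleSetoid A))
  by_contra! hlt
  -- A simple module of the category carries no `K`-structure yet; it is restricted from `A`.
  let v : ι → Quotient (simpleSetoid A) → ℤ := fun i q =>
    letI : Module K q.out.1.1 := Module.compHom _ (algebraMap K A)
    haveI : IsScalarTower K A q.out.1.1 := ⟨fun c x y => by
      rw [Algebra.smul_def, mul_smul]; rfl⟩
    eulerForm K (π i) q.out.1.1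
  have hdep : ¬ LinearIndependent ℤ v := fun hv => by
    have := hv.fintype_card_le_finrank
    rw [Module.finrank_fintype_fun_eq_card] at this
    rw [Nat.card_eq_fintype_card] at hlt
    omega
  obtain ⟨a, ha, i₀, hi₀⟩ := Fintype.not_linearIndependent_iff.1 hdep
  have hrel : ∀ (M : Type u) [AddCommGroup M] [Module A M] [Module K M] [IsScalarTower K A M]
      [FiniteDimensional K M], ∑ i, a i * eulerForm K (π i) M = 0 := by
    refine sum_eulerForm_eq_zero K π a fun S _ _ _ _ hS => ?_
    let q : Quotient (simpleSetoid A) := Quotient.mk _ ⟨ModuleCat.of A S, hS⟩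
    obtain ⟨e⟩ : Nonempty (q.out.1.1 ≃ₗ[A] S) := Quotient.exact (Quotient.out_eq q)
    let : Module K q.out.1.1 := Module.compHom _ (algebraMap K A)
    have : IsScalarTower K A q.out.1.1 := ⟨fun c x y => by
      rw [Algebra.smul_def, mul_smul]; rfl⟩
    have hq := congrFun ha q
    simp only [Finset.sum_apply, Pi.smul_apply, smul_eq_mul, Pi.zero_apply] at hq
    rw [← hq]
    exact Finset.sum_congr rfl fun i _ => by rw [← eulerForm_congr K (π i) e]
  have hhom : ∀ (M : Type u) [AddCommGroup M] [Module A M] [Module K M] [IsScalarTower K A M]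
      [FiniteDimensional K M], (∀ i, ExtVanishes (π i) M) →
      ∑ i, a i * (Module.finrank K (Z i →ₗ[A] M) : ℤ) = 0 := by
    intro M _ _ _ _ _ hM
    rw [← hrel M]
    exact Finset.sum_congr rfl fun i _ => by rw [(hM i).finrank_hom K (hπ i)]
  have htr : ∀ (s : Set ι) (q : ι) (i : ι), ExtVanishes (π i) (trace A Z s (Z q)) :=
    fun s q i => ExtVanishes.trace fun j _ => hext i j
  have hfd := fun (s : Set ι) (q : ι) => finiteDimensional_submodule K (trace A Z s (Z q))
  have hneg : ∀ q ∈ {i | a i < 0}, trace A Z {i | 0 < a i} (Z q) = ⊤ := fun q hq =>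
    trace_eq_top_of_relation K a hq (hhom _ fun i => hext i q) (hhom _ (htr _ q))
  have hpos : ∀ q ∈ {i | 0 < a i}, trace A Z {i | a i < 0} (Z q) = ⊤ := fun q hq => by
    have := trace_eq_top_of_relation K (Z := Z) (fun i => -a i) (q := q) (neg_lt_zero.2 hq)
      (by simpa using hhom _ fun i => hext i q)
      (by simpa using hhom _ (htr _ q))
    simpa using this
  rcases lt_or_gt_of_ne hi₀ with h0 | h0
  · obtain ⟨i, hi, j, hj, ⟨e⟩⟩ := exists_equiv_of_generate K hZ ⟨i₀, h0⟩ hpos hneg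
    exact (hne i j (by rintro rfl; exact lt_asymm (Set.mem_ofPred.1 hi) (Set.mem_ofPred.1 hj))).false e
  · obtain ⟨i, hi, j, hj, ⟨e⟩⟩ := exists_equiv_of_generate K hZ ⟨i₀, h0⟩ hneg hpos
    exact (hne i j (by rintro rfl; exact lt_asymm (Set.mem_ofPred.1 hi) (Set.mem_ofPred.1 hj))).false e

end RigidFamily

/-! ### Extensions, `Ext¹` and projective dimension -/

section Extensions

open CategoryTheory Abelian

variable {A : Type u} [Ring A]

theorem not_existsNonsplit_of_subsingleton_ext {U W : Type u} [AddCommGroup U] [Module A U]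
    [AddCommGroup W] [Module A W]
    (h : Subsingleton (Ext.{u} (ModuleCat.of A W) (ModuleCat.of A U) 1)) :
    ¬ ExistsNonsplit A U W := by
  rintro ⟨M, f, g, hf, hfg, hg, hns⟩
  let S : ShortComplex (ModuleCat.{u} A) :=
    ShortComplex.mk (ModuleCat.ofHom f) (ModuleCat.ofHom g)
      (ModuleCat.hom_ext (LinearMap.ext fun x => hfg.apply_apply_eq_zero x))
  have hS : S.ShortExact :=
    { exact := (ShortComplex.ShortExact.moduleCat_exact_iff_function_exact _).mpr hfg
      mono_f := (ModuleCat.mono_iff_injective _).mpr hf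
      epi_g := (ModuleCat.epi_iff_surjective _).mpr hg }
  obtain ⟨φ, hφ⟩ := Ext.covariant_sequence_exact₃ (ModuleCat.of A W) hS
    (Ext.mk₀ (𝟙 (ModuleCat.of A W))) (zero_add 1) (h.elim _ _)
  obtain ⟨ψ, rfl⟩ := (Ext.mk₀_bijective _ S.X₂).2 φ
  rw [Ext.mk₀_comp_mk₀, (Ext.mk₀_bijective _ _).1.eq_iff] at hφ
  exact hns ⟨ψ.hom, congrArg ModuleCat.Hom.hom hφ⟩

theorem not_existsNonsplit_of_projective (U W : Type u) [AddCommGroup U] [Module A U]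
    [AddCommGroup W] [Module A W] [Module.Projective A W] : ¬ ExistsNonsplit A U W := by
  rintro ⟨M, f, g, -, -, hg, hns⟩
  exact hns (Module.projective_lifting_property g LinearMap.id hg)

theorem not_existsNonsplit_of_injective (U W : Type u) [AddCommGroup U] [Module A U]
    [AddCommGroup W] [Module A W] [Module.Injective A U] : ¬ ExistsNonsplit A U W := by
  rintro ⟨M, f, g, hf, hfg, hg, hns⟩
  obtain ⟨ρ, hρ⟩ := Module.Injective.out f hf LinearMap.id
  have h : Function.Surjective g ∧ ∃ ρ, ρ ∘ₗ f = LinearMap.id := ⟨hg, ρ, LinearMap.ext hρ⟩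
  have h' : Function.Injective f ∧ ∃ σ, g ∘ₗ σ = LinearMap.id :=
    ((Function.Exact.split_tfae' hfg).out 1 0).1 h
  exact hns h'.2

/-- If every extension of `Z` by `M` splits, then the pushout of
`0 → ker π → P → Z → 0` along any map `ker π → M` splits. -/
theorem extVanishes_of_not_existsNonsplit {P Z M : Type u} [AddCommGroup P] [Module A P]
    [AddCommGroup Z] [Module A Z] [AddCommGroup M] [Module A M] (π : P →ₗ[A] Z)
    (hπ : Function.Surjective π) (h : ¬ ExistsNonsplit A M Z) : ExtVanishes π M := by
  intro f
  -- `(M × P) ⧸ D` is the pushout of `f` and the inclusion of `ker π`.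
  let D : Submodule A (M × P) := LinearMap.range (f.prod (-(LinearMap.ker π).subtype))
  have hD : D ≤ LinearMap.ker (π ∘ₗ LinearMap.snd A M P) := by
    rintro _ ⟨k, rfl⟩
    have := LinearMap.mem_ker.1 k.2
    simp [this]
  let j : M →ₗ[A] (M × P) ⧸ D := D.mkQ ∘ₗ LinearMap.inl A M P
  let q : (M × P) ⧸ D →ₗ[A] Z := D.liftQ _ hD
  have hj : Function.Injective j := by
    refine (injective_iff_map_eq_zero j).2 fun x hx => ?_
    obtain ⟨k, hk⟩ := (Submodule.Quotient.mk_eq_zero D).1 hx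
    have h2 : -(k : P) = 0 := congrArg Prod.snd hk
    have h1 : f k = x := congrArg Prod.fst hk
    rw [← h1, show k = 0 from Subtype.ext (neg_eq_zero.1 h2), map_zero]
  have hjk : ∀ k : LinearMap.ker π, D.mkQ (0, (k : P)) = j (f k) := fun k => by
    refine ((Submodule.Quotient.eq D).2 ⟨-k, ?_⟩)
    simp
  have hq : Function.Surjective q := fun z => by
    obtain ⟨x, rfl⟩ := hπ z
    exact ⟨D.mkQ (0, x), rfl⟩
  have hjq : Function.Exact j q := by
    intro y
    constructor
    · obtain ⟨⟨m, x⟩, rfl⟩ := D.mkQ_surjective y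
      intro hx
      refine ⟨m + f ⟨x, hx⟩, ?_⟩
      rw [map_add, ← hjk ⟨x, hx⟩]
      change D.mkQ (m, 0) + D.mkQ (0, x) = _
      rw [← map_add]
      simp
    · rintro ⟨m, rfl⟩
      exact π.map_zero
  obtain ⟨σ, hσ⟩ : ∃ σ : Z →ₗ[A] (M × P) ⧸ D, q ∘ₗ σ = LinearMap.id := by
    by_contra hns
    exact h ⟨ModuleCat.of A ((M × P) ⧸ D), j, q, hj, hjq, hq, hns⟩
  have hsec : Function.Injective j ∧ ∃ σ, q ∘ₗ σ = LinearMap.id := ⟨hj, σ, hσ⟩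
  have hsplit : Function.Surjective q ∧ ∃ ρ, ρ ∘ₗ j = LinearMap.id :=
    ((Function.Exact.split_tfae' hjq).out 0 1).1 hsec
  obtain ⟨-, ρ, hρ⟩ := hsplit
  exact ⟨ρ ∘ₗ D.mkQ ∘ₗ LinearMap.inr A M P, LinearMap.ext fun k =>
    (congrArg ρ (hjk k)).trans (LinearMap.congr_fun hρ (f k))⟩

/-- A finitely generated module of projective dimension at most one has a projective resolution
of length one by finitely generated modules. -/
theorem exists_presentation (Z : ModuleCat.{u} A) [Module.Finite A Z]
    (h : HasProjectiveDimensionLE Z 1) :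
    ∃ (r : ℕ) (π : (Fin r → A) →ₗ[A] Z), Function.Surjective π ∧
      Module.Projective A (LinearMap.ker π) := by
  obtain ⟨r, π, hπ⟩ := Module.Finite.exists_fin' A Z
  refine ⟨r, π, hπ, ?_⟩
  have hS := LinearMap.shortExact_shortComplexKer hπ
  have hP : Projective π.shortComplexKer.X₂ :=
    (IsProjective.iff_projective (R := A) (Fin r → A)).1 inferInstance
  have := (hS.hasProjectiveDimensionLT_X₃_iff 0 hP).1 h
  exact (IsProjective.iff_projective (R := A) (LinearMap.ker π)).2
    (projective_iff_hasProjectiveDimensionLT_one.2 this)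

theorem subsingleton_ext_of_retract {C : Type*} [Category C] [Abelian C] [HasExt.{w} C]
    {U U' V V' : C} (r : Retract U U') (r' : Retract V V') (n : ℕ)
    [Subsingleton (Ext.{w} U' V' n)] : Subsingleton (Ext.{w} U V n) := by
  refine subsingleton_of_forall_eq 0 fun x => ?_
  have h : ((Ext.mk₀ r.r).comp x (zero_add n)).comp (Ext.mk₀ r'.i) (add_zero n) = 0 :=
    Subsingleton.elim _ _
  have h' := congrArg (fun y => ((Ext.mk₀ r.i).comp y (zero_add n)).comp
    (Ext.mk₀ r'.r) (add_zero n)) h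
  simpa using h'

/-- The embedding of a summand into a direct sum, and the projection back onto it. -/
noncomputable def directSumRetract {n : ℕ} (X : Fin n → Type u) [∀ i, AddCommGroup (X i)]
    [∀ i, Module A (X i)] (i : Fin n) :
    Retract (ModuleCat.of A (X i)) (ModuleCat.of A (⨁ i, X i)) where
  i := ModuleCat.ofHom (DirectSum.lof A (Fin n) X i)
  r := ModuleCat.ofHom (DirectSum.component A (Fin n) X i)
  retract := ModuleCat.hom_ext (LinearMap.ext fun x => DirectSum.component.lof_self A i x)

theorem IsTilting.summand_pdim_le_one {n : ℕ} {X : Fin n → Type u} [∀ i, AddCommGroup (X i)]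
    [∀ i, Module A (X i)] (hX : IsTilting A (⨁ i, X i)) (i : Fin n) :
    HasProjectiveDimensionLE (ModuleCat.of A (X i)) 1 :=
  have := hX.pdim_le_one
  (directSumRetract X i).hasProjectiveDimensionLT 2

theorem IsTilting.not_existsNonsplit_summands {n : ℕ} {X : Fin n → Type u}
    [∀ i, AddCommGroup (X i)] [∀ i, Module A (X i)] (hX : IsTilting A (⨁ i, X i)) (i j : Fin n) :
    ¬ ExistsNonsplit A (X i) (X j) :=
  have := hX.ext_self
  not_existsNonsplit_of_subsingleton_ext
    (subsingleton_ext_of_retract (directSumRetract X j) (directSumRetract X i) 1)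

end Extensions

/-! ### Summands of tilting modules -/

section Counting

variable {A : Type u} [Ring A]

/-- The summands of a partial tilting module are at most as many as the simple modules. -/
theorem card_le_of_partial_tilting (K : Type w) [Field K] [Algebra K A] [FiniteDimensional K A]
    [Finite (Quotient (simpleSetoid A))]
    {ι : Type*} [Fintype ι] (T : ι → ModuleCat.{u} A) (hfin : ∀ i, Module.Finite A (T i))
    (hT : ∀ i, IsIndecomposable A (T i)) (hne : ∀ i j, i ≠ j → IsEmpty (T i ≃ₗ[A] T j))
    (hpd : ∀ i, CategoryTheory.HasProjectiveDimensionLE (T i) 1)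
    (hext : ∀ i j, ¬ ExistsNonsplit A (T i) (T j)) :
    Fintype.card ι ≤ Nat.card (Quotient (simpleSetoid A)) := by
  let : ∀ i, Module K (T i) := fun i => Module.compHom _ (algebraMap K A)
  have : ∀ i, IsScalarTower K A (T i) := fun i => ⟨fun c x y => by
    rw [Algebra.smul_def, mul_smul]; rfl⟩
  have : ∀ i, FiniteDimensional K (T i) := fun i => Module.Finite.trans A (T i)
  choose r π hπ hproj using fun i => exists_presentation (T i) (hpd i)
  exact card_le_of_extVanishes K π hπ hT hne fun i j =>
    extVanishes_of_not_existsNonsplit (π i) (hπ i) (hext j i)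

/-- By the Krull–Schmidt theorem, the number of simple modules is at most the number of
summands in a decomposition of a tilting module into indecomposable modules. -/
theorem IsTilting.card_simple_le {n : ℕ} {X : Fin n → Type u} [∀ i, AddCommGroup (X i)]
    [∀ i, Module A (X i)] [∀ i, IsNoetherian A (X i)] [∀ i, IsArtinian A (X i)]
    (hind : ∀ i, IsIndecomposable A (X i)) (hX : IsTilting A (⨁ i, X i)) :
    Finite (Quotient (simpleSetoid A)) ∧ Nat.card (Quotient (simpleSetoid A)) ≤ n := by
  obtain ⟨e⟩ := hX.card_eq
  choose c hc using fun q : Quotient (indecSummandSetoid A (⨁ i, X i)) =>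
    exists_equiv_of_isComplemented hind q.out.1 q.out.2.1 q.out.2.2
  have hinj : Function.Injective c := fun q q' h => by
    obtain ⟨f⟩ := hc q
    obtain ⟨f'⟩ := hc q'
    rw [h] at f
    rw [← Quotient.out_eq q, ← Quotient.out_eq q']
    exact Quotient.sound ⟨f.trans f'.symm⟩
  have hinj' := hinj.comp e.symm.injective
  refine ⟨Finite.of_injective _ hinj', ?_⟩
  simpa using Nat.card_le_card_of_injective _ hinj'

theorem memAdd_directSum {n : ℕ} {Y : Fin n → Type u} [∀ i, AddCommGroup (Y i)]
    [∀ i, Module A (Y i)] {M : Type u} [AddCommGroup M] [Module A M] (j : Fin n)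
    (e : M ≃ₗ[A] Y j) : MemAdd A M (⨁ i, Y i) := by
  have hinj : Function.Injective (DirectSum.lof A (Fin n) Y j) :=
    Function.LeftInverse.injective (DirectSum.component.lof_self A j)
  let L := LinearMap.range (DirectSum.lof A (Fin n) Y j)
  let e₁ : M ≃ₗ[A] L := e.trans (LinearEquiv.ofInjective _ hinj)
  let e₂ : (Fin 1 → L) ≃ₗ[A] L := LinearEquiv.funUnique (Fin 1) A L
  let e₃ : (⨁ _ : Fin 1, L) ≃ₗ[A] (Fin 1 → L) :=
    DirectSum.linearEquivFunOnFintype A (Fin 1) fun _ => L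
  refine ⟨1, fun _ => L, fun _ => ?_, ⟨(e₁.trans e₂.symm).trans e₃.symm⟩⟩
  refine ⟨LinearMap.ker (DirectSum.component A (Fin n) Y j),
    Submodule.disjoint_def.2 ?_, codisjoint_iff.2 (eq_top_iff.2 fun x _ => ?_)⟩
  · rintro _ ⟨y, rfl⟩ hy
    rw [LinearMap.mem_ker, DirectSum.component.lof_self] at hy
    rw [hy, map_zero]
  · refine Submodule.mem_sup.2 ⟨_, ⟨DirectSum.component A (Fin n) Y j x, rfl⟩,
      x - DirectSum.lof A (Fin n) Y j (DirectSum.component A (Fin n) Y j x), ?_, by abel⟩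
    rw [LinearMap.mem_ker, map_sub, DirectSum.component.lof_self, sub_self]

end Counting

end Tilting

open Tilting in
theorem mainTheorem2 {K : Type w} [Field K] {A : Type u} [Ring A] [Algebra K A]
    [FiniteDimensional K A] (n : ℕ) (X Y : Fin n → Type u)
    [∀ i, AddCommGroup (X i)] [∀ i, Module A (X i)]
    [∀ i, Module K (X i)] [∀ i, IsScalarTower K A (X i)] [∀ i, FiniteDimensional K (X i)]
    [∀ i, AddCommGroup (Y i)] [∀ i, Module A (Y i)]
    [∀ i, Module K (Y i)] [∀ i, IsScalarTower K A (Y i)] [∀ i, FiniteDimensional K (Y i)]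
    (hXind : ∀ i, Tilting.IsIndecomposable A (X i))
    (hYind : ∀ i, Tilting.IsIndecomposable A (Y i))
    (hXmf : ∀ i j, i ≠ j → IsEmpty (X i ≃ₗ[A] X j))
    (hYmf : ∀ i j, i ≠ j → IsEmpty (Y i ≃ₗ[A] Y j))
    (hX : Tilting.IsTilting A (⨁ i, X i))
    (hY : Tilting.IsTilting A (⨁ i, Y i)) :
    ∃ s : Equiv.Perm (Fin n),
      (∀ i, Module.Projective A (X i) →
        Tilting.MemAdd A (X i) (⨁ j, Y j) ∨ Tilting.ExistsNonsplit A (X i) (Y (s i))) ∧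
      (∀ i, Module.Injective A (X i) →
        Tilting.MemAdd A (X i) (⨁ j, Y j) ∨ Tilting.ExistsNonsplit A (Y (s i)) (X i)) ∧
      (∀ i, Module.Projective A (X i) → Module.Injective A (X i) →
        Tilting.MemAdd A (X i) (⨁ j, Y j) ∧ Nonempty (X i ≃ₗ[A] Y (s i))) := by
  classical
  have : ∀ i, IsNoetherian A (X i) := fun i => isNoetherian_of_tower K inferInstance
  have : ∀ i, IsArtinian A (X i) := fun i => isArtinian_of_tower K inferInstance
  obtain ⟨hfin, hcard⟩ := hX.card_simple_le hXind
  -- The third disjunct leaves the summands unconstrained that are neither projective nor injective.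
  let R : Fin n → Fin n → Prop := fun i j =>
    Nonempty (X i ≃ₗ[A] Y j) ∨
    (ExistsNonsplit A (X i) (Y j) ∨ ExistsNonsplit A (Y j) (X i)) ∨
    (¬ Module.Projective A (X i) ∧ ¬ Module.Injective A (X i))
  have hall : ∀ I : Finset (Fin n), I.card ≤ (Finset.univ.filter fun j => ∃ i ∈ I, R i j).card := by
    intro I
    set J := Finset.univ.filter fun j => ∃ i ∈ I, R i j with hJ
    by_cases hI : ∃ i ∈ I, ¬ Module.Projective A (X i) ∧ ¬ Module.Injective A (X i)
    · obtain ⟨i, hi, h⟩ := hI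
      have : J = Finset.univ := Finset.filter_true_of_mem fun j _ => ⟨i, hi, Or.inr (Or.inr h)⟩
      exact this ▸ Finset.card_le_univ I
    · have hI' : ∀ i ∈ I, Module.Projective A (X i) ∨ Module.Injective A (X i) := fun i hi => by
        by_contra h
        exact hI ⟨i, hi, not_or.1 h⟩
      have hR : ∀ (i : I) (j : (Jᶜ : Finset (Fin n))), ¬ R i j := fun i j h =>
        Finset.mem_compl.1 j.2 (Finset.mem_filter.2 ⟨Finset.mem_univ _, i, i.2, h⟩)
      -- The modules `X i`, `i ∈ I`, and `Y j`, `j ∉ J`, form a partial tilting module.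
      let T : I ⊕ (Jᶜ : Finset (Fin n)) → ModuleCat.{u} A :=
        Sum.elim (fun i => ModuleCat.of A (X i)) (fun j => ModuleCat.of A (Y j))
      have hle := card_le_of_partial_tilting K T
        (by
          rintro (i | j)
          · exact Module.Finite.of_restrictScalars_finite K A (X i)
          · exact Module.Finite.of_restrictScalars_finite K A (Y j))
        (by
          rintro (i | j)
          · exact hXind i
          · exact hYind j)
        (by
          rintro (i | j) (i' | j') h
          · exact hXmf i i' fun h' => h (congrArg Sum.inl (Subtype.ext h'))
          · exact ⟨fun e => hR i j' (Or.inl ⟨e⟩)⟩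
          · exact ⟨fun e => hR i' j (Or.inl ⟨LinearEquiv.symm e⟩)⟩
          · exact hYmf j j' fun h' => h (congrArg Sum.inr (Subtype.ext h')))
        (by
          rintro (i | j)
          · exact hX.summand_pdim_le_one i
          · exact hY.summand_pdim_le_one j)
        (by
          rintro (i | j) (i' | j')
          · exact hX.not_existsNonsplit_summands i i'
          · exact fun h => hR i j' (Or.inr (Or.inl (Or.inl h)))
          · exact fun h => hR i' j (Or.inr (Or.inl (Or.inr h)))
          · exact hY.not_existsNonsplit_summands j j')
      rw [Fintype.card_sum, Fintype.card_coe, Fintype.card_coe, Finset.card_compl,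
        Fintype.card_fin] at hle
      have := J.card_le_univ
      rw [Fintype.card_fin] at this
      omega
  obtain ⟨s, hs, hsR⟩ := (Fintype.all_card_le_filter_rel_iff_exists_injective R).1 fun I => by
      convert hall I
  refine ⟨Equiv.ofBijective s (Finite.injective_iff_bijective.1 hs), fun i hi => ?_, fun i hi => ?_,
    fun i hi hi' => ?_⟩
  · rcases hsR i with ⟨⟨e⟩⟩ | (h | h) | h
    · exact Or.inl (memAdd_directSum _ e)
    · exact Or.inr h
    · exact absurd h (not_existsNonsplit_of_projective _ _)
    · exact absurd hi h.1
  · rcases hsR i with ⟨⟨e⟩⟩ | (h | h) | h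
    · exact Or.inl (memAdd_directSum _ e)
    · exact absurd h (not_existsNonsplit_of_injective _ _)
    · exact Or.inr h
    · exact absurd hi h.2
  · rcases hsR i with ⟨⟨e⟩⟩ | (h | h) | h
    · exact ⟨memAdd_directSum _ e, ⟨e⟩⟩
    · exact absurd h (not_existsNonsplit_of_injective _ _)
    · exact absurd h (not_existsNonsplit_of_projective _ _)
    · exact absurd hi h.1
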